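/- Call a subset of the hyperbolic plane $\mathbb{H}^2$ a convex body if it is compact, convex and has non-empty interior. A straight line $L$ supports a convex body $C$ if it meets $C$ and $C$ lies in one of the two closed half-planes bounded by $L$. For such a line, $\mathrm{width}_L(C)$ is the distance between $L$ and a farthest straight line that is ultraparallel to $L$ and supports $C$. The thickness $\Delta(C)$ is the infimum (in fact minimum) of $\mathrm{width}_L(C)$ over all straight lines $L$ supporting $C$. A convex body $R\subset\mathbb{H}^2$ is reduced if $\Delta(Z)<\Delta(R)$ for every convex body $Z$ properly contained in $R$. For $k\ge 3$, a regular hyperbolic $k$-gon is the convex hull of $k$ distinct points $v_1,\dots,v_k$ of a hyperbolic circle of $\mathbb{H}^2$ such that $|v_1v_2|=\dots=|v_{k-1}v_k|=|v_kv_1|$. **Corollary.** For every odd $k\ge 3$, every regular hyperbolic $k$-gon is reduced. -/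

import Mathlib

noncomputable section

namespace HypPlane

/-- The Lorentz bilinear form on `ℝ³`. -/
def mink (x y : Fin 3 → ℝ) : ℝ := x 0 * y 0 + x 1 * y 1 - x 2 * y 2

/-- The hyperbolic plane in the hyperboloid model: the upper sheet of the two-sheeted
hyperboloid. -/
def Pt : Type := {x : Fin 3 → ℝ // x 2 = √(x 0 ^ 2 + x 1 ^ 2 + 1)}

/-- The position vector in `ℝ³` of a point of the hyperbolic plane. -/
def Pt.vec (x : Pt) : Fin 3 → ℝ := x.1

/-- The topology of the hyperbolic plane (the one of its metric) is the subspace topology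
of `ℝ³`. -/
instance : TopologicalSpace Pt := instTopologicalSpaceSubtype

/-- The hyperbolic distance: `cosh |xy| = -⟨x, y⟩`. -/
def hdist (x y : Pt) : ℝ := Real.arcosh (-(mink x.vec y.vec))

/-- The segment joining two points: the central projection of the chord to the sheet. -/
def segm (x y : Pt) : Set Pt :=
  {z | ∃ a b : ℝ, 0 ≤ a ∧ 0 ≤ b ∧ z.vec = a • x.vec + b • y.vec}

/-- Convexity of a set: it contains with any two points the segment joining them. -/
def IsConvex (C : Set Pt) : Prop := ∀ x ∈ C, ∀ y ∈ C, segm x y ⊆ C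

/-- The convex hull: the smallest convex superset. -/
def hull (S : Set Pt) : Set Pt := ⋂₀ {C | IsConvex C ∧ S ⊆ C}

/-- A convex body: a compact convex set with non-empty interior. -/
structure IsConvexBody (C : Set Pt) : Prop where
  isCompact : IsCompact C
  isConvex : IsConvex C
  nonempty_interior : (interior C).Nonempty

/-- The points of the hyperbolic plane on the plane through the origin of `ℝ³` with Lorentz
normal `n`. It is a hyperbolic straight line when `n` is space-like, that is
`0 < mink n n`, and empty for other `n ≠ 0`. -/
def lineOf (n : Fin 3 → ℝ) : Set Pt := {x | mink n x.vec = 0}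

/-- The straight line `L` supports `C`: it meets `C`, and `C` lies in one of the two closed
half-planes bounded by `L`. (Normals to both sides are allowed.) -/
def Supports (L C : Set Pt) : Prop :=
  ∃ n : Fin 3 → ℝ, 0 < mink n n ∧ L = lineOf n ∧ (∀ x ∈ C, 0 ≤ mink n x.vec) ∧
    (L ∩ C).Nonempty

/-- `L` and `M` are ultraparallel straight lines: they have no common point, neither in the
hyperbolic plane (time-like directions) nor at infinity (light-like directions). -/
def Ultraparallel (L M : Set Pt) : Prop :=
  ∃ m n : Fin 3 → ℝ, 0 < mink m m ∧ 0 < mink n n ∧ L = lineOf m ∧ M = lineOf n ∧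
    ∀ x : Fin 3 → ℝ, x ≠ 0 → mink x x ≤ 0 → ¬ (mink m x = 0 ∧ mink n x = 0)

/-- The distance between two sets. -/
def setDist (L M : Set Pt) : ℝ := sInf {d | ∃ x ∈ L, ∃ y ∈ M, d = hdist x y}

/-- The width of `C` determined by `L`: the largest distance between `L` and a straight line
supporting `C` and ultraparallel to `L`. -/
def width (L C : Set Pt) : ℝ :=
  sSup {d | ∃ M, Supports M C ∧ Ultraparallel L M ∧ d = setDist L M}

/-- The thickness of `C`: the infimum of the widths over all supporting lines. -/
def thickness (C : Set Pt) : ℝ := sInf {w | ∃ L, Supports L C ∧ w = width L C}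

/-- A reduced convex body: every convex body properly contained in it has smaller
thickness. -/
def IsReduced (R : Set Pt) : Prop :=
  IsConvexBody R ∧ ∀ Z, IsConvexBody Z → Z ⊂ R → thickness Z < thickness R

/-- `V` is a regular `k`-gon: the convex hull of `k ≥ 3` (distinct) points `v i` of a
circle, indexed modulo `k`, with all `|v i v (i + 1)|` equal. -/
def IsRegularPolygon (k : ℕ) (V : Set Pt) : Prop :=
  3 ≤ k ∧ ∃ v : ZMod k → Pt, Function.Injective v ∧
    (∃ (c : Pt) (r : ℝ), ∀ i, hdist c (v i) = r) ∧
    (∀ i j, hdist (v i) (v (i + 1)) = hdist (v j) (v (j + 1))) ∧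
    V = hull (Set.range v)

end HypPlane

end

noncomputable section

namespace HypPlane

open Real

/-! A line is encoded by a unit space-like normal `n`; then `mink n x.vec` is `sinh` of the signed
distance from `x` to the line, called its height below. For a line supporting `C` from the
nonnegative side, the width is the distance to a farthest point `q` of `C`. The line through `q`
orthogonal to the perpendicular dropped from `q` supports `C` and realises that distance
(`lineDist_le_width`). No supporting line is farther, because it meets `C` (`width_le_lineDist`).
Thickness thus becomes a min-max problem for linear functionals.

For odd `k`, let `w = sideWidth k C S` be the height of a vertex over the opposite side. A
supporting line touches the polygon at a vertex, and one of the two vertices opposite to that vertex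
has height at least `w` (`width_bound`, `IsVertexSet.sideWidth_le`). So the thickness of the polygon
is at least `lineDist w`.

A convex body `Z` properly contained in the polygon misses a vertex `x`. Over the side opposite to
`x` the height `w` is attained only at `x` (`isConvex_peak`), so all heights on `Z` are below `w`.
If the line of that side does not touch `Z`, it is slid along a common perpendicular until it does,
which raises no height on `Z` (`thickness_lt_lineDist`). By compactness of `Z` its thickness is
strictly below `lineDist w`. -/

/-! ### The Lorentz form and the future cone. -/

lemma mink_comm (x y : Fin 3 → ℝ) : mink x y = mink y x := by
  simp only [mink]; ring

lemma mink_add_right (x y z : Fin 3 → ℝ) : mink x (y + z) = mink x y + mink x z := by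
  simp only [mink, Pi.add_apply]; ring

lemma mink_smul_right (a : ℝ) (x y : Fin 3 → ℝ) : mink x (a • y) = a * mink x y := by
  simp only [mink, Pi.smul_apply, smul_eq_mul]; ring

lemma mink_add_left (x y z : Fin 3 → ℝ) : mink (x + y) z = mink x z + mink y z := by
  simp only [mink, Pi.add_apply]; ring

lemma mink_smul_left (a : ℝ) (x y : Fin 3 → ℝ) : mink (a • x) y = a * mink x y := by
  simp only [mink, Pi.smul_apply, smul_eq_mul]; ring

/-- The Gram determinant of three vectors for the Lorentz form is non-positive. -/
lemma gram_nonpos (x y z : Fin 3 → ℝ) :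
    mink x x * (mink y y * mink z z - mink y z ^ 2)
      - mink x y * (mink x y * mink z z - mink y z * mink x z)
      + mink x z * (mink x y * mink y z - mink y y * mink x z) ≤ 0 := by
  -- The form has determinant `-1`, so the Gram determinant is minus the square of the determinant
  -- of `x, y, z`.
  have h : mink x x * (mink y y * mink z z - mink y z ^ 2)
      - mink x y * (mink x y * mink z z - mink y z * mink x z)
      + mink x z * (mink x y * mink y z - mink y y * mink x z)
      = -(x 0 * (y 1 * z 2 - y 2 * z 1) - x 1 * (y 0 * z 2 - y 2 * z 0)
        + x 2 * (y 0 * z 1 - y 1 * z 0)) ^ 2 := by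
    simp only [mink]; ring
  rw [h]
  nlinarith [sq_nonneg (x 0 * (y 1 * z 2 - y 2 * z 1) - x 1 * (y 0 * z 2 - y 2 * z 0)
        + x 2 * (y 0 * z 1 - y 1 * z 0))]

lemma Pt.vec_injective : Function.Injective Pt.vec := Subtype.val_injective

lemma Pt.continuous_vec : Continuous Pt.vec := continuous_subtype_val

lemma continuous_mink (n : Fin 3 → ℝ) : Continuous fun x : Pt => mink n x.vec := by
  have h := Pt.continuous_vec
  have h0 : Continuous fun x : Pt => x.vec 0 := (continuous_apply 0).comp h
  have h1 : Continuous fun x : Pt => x.vec 1 := (continuous_apply 1).comp h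
  have h2 : Continuous fun x : Pt => x.vec 2 := (continuous_apply 2).comp h
  unfold mink
  fun_prop

lemma Pt.vec_two_pos (x : Pt) : 0 < x.vec 2 := by
  have h : x.vec 2 = √(x.vec 0 ^ 2 + x.vec 1 ^ 2 + 1) := x.2
  rw [h]; positivity

lemma Pt.vec_two_sq (x : Pt) : x.vec 2 ^ 2 = x.vec 0 ^ 2 + x.vec 1 ^ 2 + 1 := by
  have h : x.vec 2 = √(x.vec 0 ^ 2 + x.vec 1 ^ 2 + 1) := x.2
  rw [h, sq_sqrt (by positivity)]

lemma mink_self (x : Pt) : mink x.vec x.vec = -1 := by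
  have := x.vec_two_sq
  simp only [mink]; linarith

/-- The open future light cone. -/
def Future (p : Fin 3 → ℝ) : Prop := mink p p < 0 ∧ 0 < p 2

lemma Pt.future (x : Pt) : Future x.vec := ⟨by rw [mink_self]; norm_num, x.vec_two_pos⟩

lemma Future.mink_neg {p q : Fin 3 → ℝ} (hp : Future p) (hq : Future q) : mink p q < 0 := by
  obtain ⟨hp, hp2⟩ := hp
  obtain ⟨hq, hq2⟩ := hq
  simp only [mink] at *
  have h : (p 0 * q 0 + p 1 * q 1) ^ 2 < (p 2 * q 2) ^ 2 := by
    have h1 : (p 0 * q 0 + p 1 * q 1) ^ 2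
        ≤ (p 0 ^ 2 + p 1 ^ 2) * (q 0 ^ 2 + q 1 ^ 2) := by
      nlinarith [sq_nonneg (p 0 * q 1 - p 1 * q 0)]
    have h2 : (p 0 ^ 2 + p 1 ^ 2) * (q 0 ^ 2 + q 1 ^ 2) < p 2 ^ 2 * q 2 ^ 2 :=
      mul_lt_mul'' (by linarith) (by linarith) (by positivity) (by positivity)
    linarith [mul_pow (p 2) (q 2) 2]
  have := abs_lt_of_sq_lt_sq h (by positivity)
  linarith [(abs_lt.1 this).2]

lemma Future.smul {p : Fin 3 → ℝ} (hp : Future p) {a : ℝ} (ha : 0 < a) : Future (a • p) := by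
  refine ⟨?_, by simpa using mul_pos ha hp.2⟩
  rw [mink_smul_left, mink_smul_right]
  nlinarith [mul_pos ha ha, hp.1]

lemma Future.add {p q : Fin 3 → ℝ} (hp : Future p) (hq : Future q) : Future (p + q) := by
  refine ⟨?_, by simpa using add_pos hp.2 hq.2⟩
  have := hp.mink_neg hq
  rw [mink_add_left, mink_add_right, mink_add_right, mink_comm q p]
  linarith [hp.1, hq.1]

/-- Reversed Cauchy–Schwarz inequality. It puts the argument of `arcosh` in `hdist` into the range
where `arcosh` is injective. -/
lemma one_le_neg_mink (x y : Pt) : 1 ≤ -mink x.vec y.vec := by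
  have h := x.future.mink_neg y.future
  have hx := x.vec_two_sq
  have hy := y.vec_two_sq
  have hx2 := x.vec_two_pos
  have hy2 := y.vec_two_pos
  simp only [mink] at *
  have h1 : (x.vec 0 * y.vec 0 + x.vec 1 * y.vec 1 + 1) ^ 2 ≤ (x.vec 2 * y.vec 2) ^ 2 := by
    rw [mul_pow, hx, hy]
    nlinarith [sq_nonneg (x.vec 0 * y.vec 1 - x.vec 1 * y.vec 0),
      sq_nonneg (x.vec 0 - y.vec 0), sq_nonneg (x.vec 1 - y.vec 1)]
  linarith [(abs_le.1 (abs_le_of_sq_le_sq h1 (by positivity))).2]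

/-! ### Central projection to the hyperboloid. -/

/-- The radial projection of the future light cone to the hyperboloid. -/
def radial (p : Fin 3 → ℝ) : Pt :=
  ⟨![p 0 / √(-mink p p), p 1 / √(-mink p p),
    √((p 0 / √(-mink p p)) ^ 2 + (p 1 / √(-mink p p)) ^ 2 + 1)], by simp⟩

lemma radial_vec {p : Fin 3 → ℝ} (hp : Future p) :
    (radial p).vec = (√(-mink p p))⁻¹ • p := by
  have hs : 0 < √(-mink p p) := sqrt_pos.2 (by linarith [hp.1])
  have hsq : √(-mink p p) ^ 2 = -mink p p := sq_sqrt (by linarith [hp.1])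
  have h2 : √((p 0 / √(-mink p p)) ^ 2 + (p 1 / √(-mink p p)) ^ 2 + 1)
      = p 2 / √(-mink p p) := by
    rw [sqrt_eq_iff_mul_self_eq_of_pos (div_pos hp.2 hs)]
    field_simp
    rw [hsq]; simp only [mink]; ring
  ext i
  fin_cases i
  · simp [radial, Pt.vec, div_eq_inv_mul]
  · simp [radial, Pt.vec, div_eq_inv_mul]
  · simp only [radial, Pt.vec, h2]
    simp [div_eq_inv_mul]

lemma continuousOn_radial : ContinuousOn radial {p | Future p} := by
  have hs : ∀ p ∈ {p | Future p}, √(-mink p p) ≠ 0 := fun p hp =>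
    (sqrt_pos.2 (by linarith [hp.1])).ne'
  have hm : Continuous fun p : Fin 3 → ℝ => √(-mink p p) := by
    unfold mink; fun_prop
  refine Topology.IsInducing.subtypeVal.continuousOn_iff.2 (continuousOn_pi.2 fun i => ?_)
  have h0 : ContinuousOn (fun p : Fin 3 → ℝ => p 0 / √(-mink p p)) {p | Future p} :=
    ((continuous_apply 0).continuousOn).div hm.continuousOn hs
  have h1 : ContinuousOn (fun p : Fin 3 → ℝ => p 1 / √(-mink p p)) {p | Future p} :=
    ((continuous_apply 1).continuousOn).div hm.continuousOn hs
  fin_cases i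
  · exact h0
  · exact h1
  · exact (((h0.pow 2).add (h1.pow 2)).add continuousOn_const).sqrt

/-- Positive multiples of points determine the points. -/
lemma Pt.eq_of_smul {x y : Pt} {a b : ℝ} (ha : 0 < a) (hb : 0 < b)
    (h : a • x.vec = b • y.vec) : x = y := by
  have h1 : mink (a • x.vec) (a • x.vec) = mink (b • y.vec) (b • y.vec) := by rw [h]
  simp only [mink_smul_left, mink_smul_right, mink_self] at h1
  have : a = b := by nlinarith
  subst this
  exact Pt.vec_injective (smul_right_injective _ ha.ne' h)

lemma exists_smul_eq {p : Fin 3 → ℝ} (hp : Future p) :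
    ∃ t : ℝ, 0 < t ∧ p = t • (radial p).vec := by
  have hs : 0 < √(-mink p p) := sqrt_pos.2 (by linarith [hp.1])
  exact ⟨_, hs, by rw [radial_vec hp, smul_inv_smul₀ hs.ne']⟩

lemma radial_smul {t : ℝ} (ht : 0 < t) (x : Pt) : radial (t • x.vec) = x := by
  obtain ⟨s, hs, h⟩ := exists_smul_eq (x.future.smul ht)
  exact Pt.eq_of_smul hs ht h.symm

/-! ### Convex hulls and convex bodies. -/

lemma subset_hull (S : Set Pt) : S ⊆ hull S := fun _ hx _ hC => hC.2 hx

lemma hull_subset {S C : Set Pt} (hC : IsConvex C) (h : S ⊆ C) : hull S ⊆ C :=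
  fun _ hx => hx C ⟨hC, h⟩

lemma isConvex_hull (S : Set Pt) : IsConvex (hull S) := fun x hx y hy _ hz C hC =>
  hC.1 x (hx C hC) y (hy C hC) hz

/-- The coefficients of a point of a segment: they are not both zero and their sum is at
most one. -/
lemma segm_coeff {x y z : Pt} {a b : ℝ} (ha : 0 ≤ a) (hb : 0 ≤ b)
    (h : z.vec = a • x.vec + b • y.vec) : 0 < a + b ∧ a + b ≤ 1 := by
  have h1 := mink_self z
  rw [h] at h1
  simp only [mink_smul_left, mink_smul_right, mink_add_left, mink_add_right, mink_self,
    mink_comm y.vec x.vec] at h1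
  -- Since `-mink x.vec y.vec ≥ 1`, the square `(a + b) ^ 2` is at most `-mink z.vec z.vec = 1`.
  have h2 := one_le_neg_mink x y
  have hab := mul_nonneg ha hb
  constructor
  · rcases (add_nonneg ha hb).eq_or_lt with h0 | h0
    · have : a = 0 := by linarith
      have : b = 0 := by linarith
      subst_vars; norm_num at h1
    · exact h0
  · nlinarith

lemma future_combo {x y : Pt} {a b : ℝ} (ha : 0 ≤ a) (hb : 0 ≤ b) (hab : 0 < a + b) :
    Future (a • x.vec + b • y.vec) := by
  rcases ha.eq_or_lt with rfl | ha
  · simpa using y.future.smul (by linarith)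
  rcases hb.eq_or_lt with rfl | hb
  · simpa using x.future.smul ha
  exact (x.future.smul ha).add (y.future.smul hb)

/-- The cone over a convex set is convex in the linear sense. -/
lemma IsConvex.convex_cone {C : Set Pt} (hC : IsConvex C) :
    Convex ℝ {p : Fin 3 → ℝ | ∃ t : ℝ, 0 < t ∧ ∃ x ∈ C, p = t • x.vec} := by
  rintro _ ⟨s, hs, x, hx, rfl⟩ _ ⟨t, ht, y, hy, rfl⟩ a b ha hb hab
  have h1 : 0 < a * s + b * t := by
    rcases ha.eq_or_lt with rfl | ha
    · have : b = 1 := by linarith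
      subst this; simpa using ht
    · have := mul_pos ha hs
      have := mul_nonneg hb ht.le
      linarith
  obtain ⟨r, hr, h⟩ := exists_smul_eq
    (future_combo (x := x) (y := y) (mul_nonneg ha hs.le) (mul_nonneg hb ht.le) h1)
  refine ⟨r, hr, radial ((a * s) • x.vec + (b * t) • y.vec), hC x hx y hy ⟨r⁻¹ * (a * s), r⁻¹ * (b * t), by positivity, by positivity, ?_⟩,
    by simpa only [smul_smul] using h⟩
  rw [mul_smul r⁻¹, mul_smul r⁻¹, ← smul_add]
  exact (eq_inv_smul_iff₀ hr.ne').2 h.symm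

lemma future_of_mem_convexHull {S : Set Pt} {p : Fin 3 → ℝ}
    (hp : p ∈ convexHull ℝ (Pt.vec '' S)) :
    Future p ∧ radial p ∈ hull S := by
  have h : convexHull ℝ (Pt.vec '' S) ⊆
      {p : Fin 3 → ℝ | ∃ t : ℝ, 0 < t ∧ ∃ x ∈ hull S, p = t • x.vec} := by
    refine convexHull_min ?_ (isConvex_hull S).convex_cone
    rintro _ ⟨x, hx, rfl⟩
    exact ⟨1, one_pos, x, subset_hull S hx, by simp⟩
  obtain ⟨t, ht, x, hx, rfl⟩ := h hp
  exact ⟨x.future.smul ht, by rwa [radial_smul ht]⟩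

/-- Hyperbolic segments are central projections of chords, so hyperbolic and linear convexity agree
on cones. Compactness of hulls of finite sets is thereby inherited from `ℝ³`. -/
lemma hull_eq_image (S : Set Pt) : hull S = radial '' convexHull ℝ (Pt.vec '' S) := by
  apply Set.Subset.antisymm
  · refine hull_subset ?_ ?_
    · rintro _ ⟨p, hp, rfl⟩ _ ⟨q, hq, rfl⟩ z ⟨a, b, ha, hb, hz⟩
      obtain ⟨hab, -⟩ := segm_coeff ha hb hz
      obtain ⟨s, hs, hps⟩ := exists_smul_eq (future_of_mem_convexHull hp).1
      obtain ⟨t, ht, hqt⟩ := exists_smul_eq (future_of_mem_convexHull hq).1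
      -- The coefficients with respect to `p` and `q` must be normalised to sum one; `radial`
      -- ignores the positive factor.
      have h1 : 0 < a / s + b / t := by
        rcases ha.eq_or_lt with rfl | ha
        · have : 0 < b / t := div_pos (by linarith) ht
          simpa using this
        · have := div_pos ha hs
          have := div_nonneg hb ht.le
          linarith
      refine ⟨(a / s / (a / s + b / t)) • p + (b / t / (a / s + b / t)) • q,
        convex_convexHull ℝ _ hp hq (by positivity) (by positivity) ?_, ?_⟩
      · rw [← add_div, div_self h1.ne']
      · have : (a / s / (a / s + b / t)) • p + (b / t / (a / s + b / t)) • q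
            = (a / s + b / t)⁻¹ • z.vec := by
          rw [hz]
          conv_lhs => rw [hps, hqt]
          rw [smul_smul, smul_smul, smul_add, smul_smul, smul_smul]
          congr 2 <;> field_simp
        rw [this, radial_smul (inv_pos.2 h1)]
    · intro x hx
      exact ⟨x.vec, subset_convexHull ℝ _ ⟨x, hx, rfl⟩, by simpa using radial_smul one_pos x⟩
  · rintro _ ⟨p, hp, rfl⟩
    exact (future_of_mem_convexHull hp).2

lemma isCompact_hull {S : Set Pt} (hS : S.Finite) : IsCompact (hull S) := by
  rw [hull_eq_image]
  exact (hS.image _).isCompact_convexHull ℝ |>.image_of_continuousOn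
    (continuousOn_radial.mono fun p hp => (future_of_mem_convexHull hp).1)

lemma mem_hull_of_sum {S : Set Pt} {ι : Type*} [Fintype ι] [Nonempty ι] {v : ι → Pt}
    (hv : ∀ i, v i ∈ S) {a : ι → ℝ} (ha : ∀ i, 0 < a i) {z : Pt}
    (hz : z.vec = ∑ i, a i • (v i).vec) : z ∈ hull S := by
  have hs : 0 < ∑ i, a i := Finset.sum_pos (fun i _ => ha i) Finset.univ_nonempty
  rw [hull_eq_image]
  refine ⟨(∑ i, a i)⁻¹ • z.vec, ?_, radial_smul (inv_pos.2 hs) z⟩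
  rw [hz]
  have := Convex.centerMass_mem (convex_convexHull ℝ (Pt.vec '' S)) (t := Finset.univ) (w := a)
    (z := fun i => (v i).vec) (fun i _ => (ha i).le) hs
    (fun i _ => subset_convexHull ℝ (Pt.vec '' S) ⟨v i, hv i, rfl⟩)
  exact this

/-- The hull of a set with three linearly independent points has interior points. -/
lemma interior_hull_nonempty {S : Set Pt} {v : Fin 3 → Pt} (hv : ∀ i, v i ∈ S)
    (hli : LinearIndependent ℝ fun i => (v i).vec) : (interior (hull S)).Nonempty := by
  let b := basisOfLinearIndependentOfCardEqFinrank hli (by simp)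
  have hb : ∀ i, b i = (v i).vec := fun i => by simp [b]
  have hopen : IsOpen {x : Pt | ∀ i, 0 < b.repr x.vec i} := by
    simp only [Set.ofPred_forall]
    refine isOpen_iInter_of_finite fun i => isOpen_lt continuous_const ?_
    exact ((b.coord i).continuous_of_finiteDimensional).comp Pt.continuous_vec
  have hsub : {x : Pt | ∀ i, 0 < b.repr x.vec i} ⊆ hull S := by
    intro x hx
    refine mem_hull_of_sum hv hx ?_
    conv_lhs => rw [← b.sum_repr x.vec]
    simp [hb]
  have hf : Future ((v 0).vec + (v 1).vec + (v 2).vec) :=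
    ((v 0).future.add (v 1).future).add (v 2).future
  obtain ⟨t, ht, h⟩ := exists_smul_eq hf
  -- The projected barycentre has all three coordinates equal to `1 / t`.
  refine ⟨radial ((v 0).vec + (v 1).vec + (v 2).vec), interior_maximal hsub hopen fun i => ?_⟩
  have h1 : t * b.repr (radial ((v 0).vec + (v 1).vec + (v 2).vec)).vec i = 1 := by
    have h2 := congrArg (fun p => b.repr p i) h
    simp only [← hb, map_add, map_smul, Finsupp.add_apply, Finsupp.smul_apply,
      Module.Basis.repr_self, smul_eq_mul] at h2 ⊢
    rw [← h2]
    fin_cases i <;> simp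
  by_contra hneg
  nlinarith

lemma isConvexBody_hull {S : Set Pt} (hS : S.Finite) {v : Fin 3 → Pt} (hv : ∀ i, v i ∈ S)
    (hli : LinearIndependent ℝ fun i => (v i).vec) : IsConvexBody (hull S) :=
  ⟨isCompact_hull hS, isConvex_hull S, interior_hull_nonempty hv hli⟩

/-! ### Convex sets cut out by linear functionals. -/

lemma isConvex_nonneg (n : Fin 3 → ℝ) : IsConvex {x | 0 ≤ mink n x.vec} := by
  rintro x hx y hy z ⟨a, b, ha, hb, hz⟩
  simp only [Set.mem_ofPred_eq] at *
  rw [hz, mink_add_right, mink_smul_right, mink_smul_right]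
  positivity

lemma isConvex_pos (n : Fin 3 → ℝ) : IsConvex {x | 0 < mink n x.vec} := by
  rintro x hx y hy z ⟨a, b, ha, hb, hz⟩
  obtain ⟨hab, -⟩ := segm_coeff ha hb hz
  simp only [Set.mem_ofPred_eq] at *
  rw [hz, mink_add_right, mink_smul_right, mink_smul_right]
  rcases ha.eq_or_lt with rfl | ha
  · have := mul_pos (by linarith : 0 < b) hy
    linarith
  · have := mul_pos ha hx
    have := mul_nonneg hb hy.le
    linarith

/-- A linear functional has a peak in `p` if it is smaller than there everywhere else. -/
lemma isConvex_peak (n : Fin 3 → ℝ) (p : Pt) (hp : 0 < mink n p.vec) :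
    IsConvex {x | x = p ∨ mink n x.vec < mink n p.vec} := by
  have key : ∀ x y z : Pt, ∀ a b : ℝ, 0 ≤ a → 0 ≤ b → z.vec = a • x.vec + b • y.vec →
      mink n x.vec ≤ mink n p.vec → mink n y.vec < mink n p.vec →
      z = x ∨ mink n z.vec < mink n p.vec := by
    intro x y z a b ha hb hz hx hy
    obtain ⟨h0, h1⟩ := segm_coeff ha hb hz
    rcases hb.eq_or_lt with rfl | hb
    · left
      refine Pt.eq_of_smul one_pos (by linarith : 0 < a) ?_
      simpa using hz
    · right
      rw [hz, mink_add_right, mink_smul_right, mink_smul_right]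
      -- The combination stays below `(a + b) * mink n p.vec`; as `a + b ≤ 1`, this is where
      -- positivity at `p` is needed.
      nlinarith [mul_lt_mul_of_pos_left hy hb, mul_le_mul_of_nonneg_left hx ha]
  rintro x hx y hy z ⟨a, b, ha, hb, hz⟩
  rcases hx with rfl | hx
  · rcases hy with rfl | hy
    · left
      have h := (segm_coeff ha hb hz).1
      rw [← add_smul] at hz
      exact Pt.eq_of_smul one_pos h (by simpa using hz)
    · exact key _ _ _ _ _ ha hb hz le_rfl hy
  · rcases hy with rfl | hy
    · exact key _ _ _ _ _ hb ha (by rw [hz, add_comm]) le_rfl hx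
    · rcases key _ _ _ _ _ ha hb hz hx.le hy with rfl | h
      · exact Or.inr hx
      · exact Or.inr h

/-! ### Distances from lines, widths and thickness. -/

/-- For points `x` of the line with unit normal `n`: the distance from `x` to `y` is at least
the distance from the line to `y`. -/
lemma sqrt_le_neg_mink {n : Fin 3 → ℝ} (hn : mink n n = 1) {x y : Pt}
    (hx : mink n x.vec = 0) : √(1 + mink n y.vec ^ 2) ≤ -mink x.vec y.vec := by
  have h := gram_nonpos n x.vec y.vec
  rw [hn, hx, mink_self, mink_self] at h
  apply sqrt_le_iff.2
  have := one_le_neg_mink x y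
  constructor
  · linarith
  · nlinarith

/-- The foot of the perpendicular is found by removing the `n`-component of `q` and projecting back
to the hyperboloid. -/
lemma exists_foot {n : Fin 3 → ℝ} (hn : mink n n = 1) (q : Pt) :
    ∃ x : Pt, mink n x.vec = 0 ∧ -mink x.vec q.vec = √(1 + mink n q.vec ^ 2) := by
  set y := mink n q.vec with hy
  set s := √(1 + y ^ 2) with hs
  have hs0 : 0 < s := sqrt_pos.2 (by positivity)
  have hs2 : s ^ 2 = 1 + y ^ 2 := sq_sqrt (by positivity)
  have hqn : mink q.vec n = y := mink_comm _ _
  set p := q.vec + (-y) • n with hp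
  have hpp : mink p p = -s ^ 2 := by
    rw [hp]
    simp only [mink_add_left, mink_add_right, mink_smul_left, mink_smul_right, mink_self, hn,
      hqn, ← hy, hs2]
    ring
  have hpq : mink p q.vec = -s ^ 2 := by
    rw [hp]
    simp only [mink_add_left, mink_smul_left, mink_self, ← hy, hs2]
    ring
  have hnp : mink n p = 0 := by
    rw [hp]
    simp only [mink_add_right, mink_smul_right, hn, ← hy]
    ring
  -- `p` is time-like; if it were past-directed, `-p` and `q` would both be future vectors with
  -- positive product.
  have hfut : Future p := by
    refine ⟨by rw [hpp]; nlinarith, ?_⟩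
    by_contra hneg
    have h1 : Future (-p) := by
      have h2 : p 2 ≠ 0 := by
        intro h0
        have := hpp
        simp only [mink, h0] at this
        nlinarith [sq_nonneg (p 0), sq_nonneg (p 1)]
      refine ⟨?_, ?_⟩
      · have : mink (-p) (-p) = mink p p := by simp [mink]
        rw [this, hpp]; nlinarith
      · simp only [Pi.neg_apply]
        rcases lt_or_gt_of_ne h2 with h | h
        · linarith
        · exact absurd h hneg
    have h3 := h1.mink_neg q.future
    have h4 : mink (-p) q.vec = - mink p q.vec := by simp [mink]; ring
    rw [h4, hpq] at h3
    nlinarith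
  refine ⟨radial p, ?_, ?_⟩
  · rw [radial_vec hfut, mink_smul_right, hnp, mul_zero]
  · rw [radial_vec hfut, mink_smul_left, hpp, hpq, neg_neg, sqrt_sq hs0.le]
    field_simp

lemma hdist_nonneg (x y : Pt) : 0 ≤ hdist x y := arcosh_nonneg (one_le_neg_mink x y)

lemma setDist_nonneg (L M : Set Pt) : 0 ≤ setDist L M :=
  Real.sInf_nonneg (by rintro _ ⟨x, -, y, -, rfl⟩; exact hdist_nonneg x y)

lemma setDist_le {L M : Set Pt} {x y : Pt} (hx : x ∈ L) (hy : y ∈ M) :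
    setDist L M ≤ hdist x y :=
  csInf_le ⟨0, by rintro _ ⟨x, -, y, -, rfl⟩; exact hdist_nonneg x y⟩ ⟨x, hx, y, hy, rfl⟩

lemma width_nonneg (L C : Set Pt) : 0 ≤ width L C :=
  Real.sSup_nonneg (by rintro _ ⟨M, -, -, rfl⟩; exact setDist_nonneg L M)

lemma thickness_le {L C : Set Pt} (h : Supports L C) : thickness C ≤ width L C :=
  csInf_le ⟨0, by rintro _ ⟨L, -, rfl⟩; exact width_nonneg L C⟩ ⟨L, h, rfl⟩

/-- The distance `arsinh W` from a line with unit normal `n` of the points `x` with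
`mink n x.vec = W`. -/
def lineDist (W : ℝ) : ℝ := arcosh √(1 + W ^ 2)

lemma one_le_sqrt_one_add_sq (W : ℝ) : 1 ≤ √(1 + W ^ 2) := by
  rw [one_le_sqrt]; nlinarith [sq_nonneg W]

lemma lineDist_nonneg (W : ℝ) : 0 ≤ lineDist W := arcosh_nonneg (one_le_sqrt_one_add_sq W)

lemma lineDist_le_lineDist {a b : ℝ} (ha : 0 ≤ a) (hab : a ≤ b) : lineDist a ≤ lineDist b := by
  refine (arcosh_le_arcosh (by positivity) (by positivity)).2 (sqrt_le_sqrt ?_)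
  gcongr

lemma lineDist_lt_lineDist {a b : ℝ} (ha : 0 ≤ a) (hab : a < b) : lineDist a < lineDist b := by
  refine (arcosh_lt_arcosh (by positivity) (by positivity)).2 (sqrt_lt_sqrt (by positivity) ?_)
  gcongr

/-- A supporting line contains a point of `C`, whose height is at most `W`; the distance from its
foot bounds the distance of the lines. -/
lemma setDist_le_lineDist {n : Fin 3 → ℝ} (hn : mink n n = 1) {C M : Set Pt} {W : ℝ}
    (h0 : ∀ x ∈ C, 0 ≤ mink n x.vec) (hW : ∀ x ∈ C, mink n x.vec ≤ W) (hM : Supports M C) :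
    setDist (lineOf n) M ≤ lineDist W := by
  obtain ⟨-, -, -, -, q, hqM, hqC⟩ := hM
  obtain ⟨x, hx, hxq⟩ := exists_foot hn q
  calc setDist (lineOf n) M ≤ hdist x q := setDist_le hx hqM
    _ = lineDist (mink n q.vec) := by rw [hdist, hxq, lineDist]
    _ ≤ lineDist W := lineDist_le_lineDist (h0 q hqC) (hW q hqC)

lemma width_le_lineDist {n : Fin 3 → ℝ} (hn : mink n n = 1) {C : Set Pt} {W : ℝ}
    (h0 : ∀ x ∈ C, 0 ≤ mink n x.vec) (hW : ∀ x ∈ C, mink n x.vec ≤ W) :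
    width (lineOf n) C ≤ lineDist W := by
  refine Real.sSup_le ?_ (lineDist_nonneg W)
  rintro _ ⟨M, hM, -, rfl⟩
  exact setDist_le_lineDist hn h0 hW hM

/-- A farthest point from a supporting line determines the width. -/
lemma lineDist_le_width {n : Fin 3 → ℝ} (hn : mink n n = 1) {C : Set Pt} {q : Pt} (hq : q ∈ C)
    (h0 : ∀ x ∈ C, 0 ≤ mink n x.vec) (hW : ∀ x ∈ C, mink n x.vec ≤ mink n q.vec)
    (hpos : 0 < mink n q.vec) : lineDist (mink n q.vec) ≤ width (lineOf n) C := by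
  set W := mink n q.vec with hWdef
  -- Normal of the line through `q` orthogonal to the perpendicular from `q`; the sign puts `C` on
  -- its nonnegative side.
  set m : Fin 3 → ℝ := (-1 : ℝ) • n + (-W) • q.vec with hm
  have hqn : mink q.vec n = W := mink_comm _ _
  have hmx : ∀ x, mink m x = -mink n x - W * mink q.vec x := by
    intro x
    rw [hm, mink_add_left, mink_smul_left, mink_smul_left]; ring
  have hmm : mink m m = 1 + W ^ 2 := by
    rw [hmx, mink_comm n, mink_comm q.vec, hmx, hmx, hn, hqn, mink_self, ← hWdef]; ring
  have hmq : mink m q.vec = 0 := by rw [hmx, mink_self, ← hWdef]; ring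
  have hmpos : 0 < mink m m := by rw [hmm]; positivity
  have hdist_le : lineDist W ≤ setDist (lineOf n) (lineOf m) := by
    obtain ⟨f, hf, -⟩ := exists_foot hn q
    refine le_csInf ⟨_, f, hf, q, hmq, rfl⟩ ?_
    rintro _ ⟨x, hx, y, hy, rfl⟩
    have hy' : mink m y.vec = 0 := hy
    rw [hmx] at hy'
    have h1 := one_le_neg_mink q y
    -- On this line the height is `W * -mink q.vec y.vec`, hence smallest at `q`.
    have h2 : W ≤ mink n y.vec := by nlinarith
    refine (lineDist_le_lineDist hpos.le h2).trans ?_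
    exact (arcosh_le_arcosh (by positivity) (by linarith [one_le_neg_mink x y])).2
      (sqrt_le_neg_mink hn hx)
  refine hdist_le.trans (le_csSup ⟨lineDist W, ?_⟩ ⟨lineOf m, ?_, ?_, rfl⟩)
  · rintro _ ⟨M, hM, -, rfl⟩
    exact setDist_le_lineDist hn h0 hW hM
  · refine ⟨m, hmpos, rfl, fun x hx => ?_, q, hmq, hq⟩
    rw [hmx]
    nlinarith [one_le_neg_mink q x, hW x hx]
  -- A vector orthogonal to `n` and `m` is orthogonal to the time-like `q.vec`, so it is space-like
  -- or zero.
  · refine ⟨n, m, by rw [hn]; norm_num, hmpos, rfl, rfl, ?_⟩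
    rintro x hx0 hx ⟨hnx, hmx0⟩
    rw [hmx, hnx] at hmx0
    have hqx : mink q.vec x = 0 := by
      have : W * mink q.vec x = 0 := by linarith
      exact (mul_eq_zero.1 this).resolve_left hpos.ne'
    apply hx0
    have hq2 := q.vec_two_sq
    have hq3 := q.vec_two_pos
    simp only [mink] at hqx hx
    have h1 : (q.vec 0 * x 0 + q.vec 1 * x 1) ^ 2
        ≤ (q.vec 0 ^ 2 + q.vec 1 ^ 2) * (x 0 ^ 2 + x 1 ^ 2) := by
      nlinarith [sq_nonneg (q.vec 0 * x 1 - q.vec 1 * x 0)]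
    have h2 : (q.vec 0 * x 0 + q.vec 1 * x 1) ^ 2 = q.vec 2 ^ 2 * x 2 ^ 2 := by
      rw [← mul_pow]; congr 1; linarith
    have h3 : x 0 ^ 2 + x 1 ^ 2 = 0 := by
      have : (q.vec 0 ^ 2 + q.vec 1 ^ 2 + 1) * (x 0 ^ 2 + x 1 ^ 2)
          ≤ q.vec 2 ^ 2 * x 2 ^ 2 := by
        rw [hq2]; gcongr; linarith
      nlinarith [sq_nonneg (x 0), sq_nonneg (x 1)]
    have h4 : x 0 = 0 := by nlinarith [sq_nonneg (x 0), sq_nonneg (x 1)]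
    have h5 : x 1 = 0 := by nlinarith [sq_nonneg (x 0), sq_nonneg (x 1)]
    have h6 : x 2 = 0 := by
      rw [h4, h5] at hqx
      have : q.vec 2 * x 2 = 0 := by linarith
      exact (mul_eq_zero.1 this).resolve_left hq3.ne'
    ext i
    fin_cases i <;> simp [h4, h5, h6]

/-- Supporting lines have unit normals. -/
lemma Supports.exists_unit_normal {L C : Set Pt} (h : Supports L C) :
    ∃ n : Fin 3 → ℝ, mink n n = 1 ∧ L = lineOf n ∧ (∀ x ∈ C, 0 ≤ mink n x.vec) ∧
      ∃ x ∈ C, mink n x.vec = 0 := by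
  obtain ⟨n, hn, rfl, h0, x, hxL, hxC⟩ := h
  have hs : 0 < √(mink n n) := sqrt_pos.2 hn
  have hs2 : √(mink n n) ^ 2 = mink n n := sq_sqrt hn.le
  refine ⟨(√(mink n n))⁻¹ • n, ?_, ?_, ?_, x, hxC, ?_⟩
  · rw [mink_smul_left, mink_smul_right]
    field_simp
    exact hs2.symm
  · ext y
    simp only [lineOf, Set.mem_ofPred_eq, mink_smul_left, mul_eq_zero, inv_eq_zero, hs.ne',
      false_or]
  · intro y hy
    rw [mink_smul_left]
    exact mul_nonneg (inv_nonneg.2 hs.le) (h0 y hy)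
  · have : mink n x.vec = 0 := hxL
    rw [mink_smul_left, this, mul_zero]

/-- Lower bound for the thickness from a lower bound for the unit normals of supporting
lines. -/
lemma lineDist_le_thickness {C : Set Pt} (hC : IsCompact C) {w : ℝ} (hw : 0 < w)
    (hne : ∃ L, Supports L C)
    (h : ∀ n : Fin 3 → ℝ, mink n n = 1 → (∀ x ∈ C, 0 ≤ mink n x.vec) →
      (∃ x ∈ C, mink n x.vec = 0) → ∃ q ∈ C, w ≤ mink n q.vec) :
    lineDist w ≤ thickness C := by
  obtain ⟨L₀, hL₀⟩ := hne
  refine le_csInf ⟨_, L₀, hL₀, rfl⟩ ?_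
  rintro _ ⟨L, hL, rfl⟩
  obtain ⟨n, hn, rfl, h0, x, hx, hx0⟩ := hL.exists_unit_normal
  obtain ⟨q, hq, hwq⟩ := h n hn h0 ⟨x, hx, hx0⟩
  obtain ⟨p, hp, hmax⟩ := hC.exists_isMaxOn ⟨x, hx⟩ (continuous_mink n).continuousOn
  have hwp : w ≤ mink n p.vec := hwq.trans (hmax hq)
  exact (lineDist_le_lineDist hw.le hwp).trans
    (lineDist_le_width hn hp h0 (fun y hy => hmax hy) (hw.trans_le hwp))

/-- Upper bound for the thickness of a body on one side of a line, which need not be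
supporting: a line of a pencil orthogonal to a common perpendicular is. -/
lemma thickness_lt_lineDist {C : Set Pt} (hC : IsCompact C) (hCne : C.Nonempty)
    {n : Fin 3 → ℝ} (hn : mink n n = 1) {w : ℝ} (h0 : ∀ x ∈ C, 0 ≤ mink n x.vec)
    (hw : ∀ x ∈ C, mink n x.vec < w) : thickness C < lineDist w := by
  obtain ⟨z, hz⟩ := hCne
  obtain ⟨e, he, -⟩ := exists_foot hn z
  have hen : mink e.vec n = 0 := by rw [mink_comm, he]
  have hg : ∀ x : Pt, 0 < -mink e.vec x.vec := fun x => by linarith [one_le_neg_mink e x]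
  have hlt : ∀ x : Pt, mink n x.vec < -mink e.vec x.vec := by
    intro x
    refine lt_of_lt_of_le ?_ (sqrt_le_neg_mink hn he)
    exact lt_sqrt_of_sq_lt (by linarith)
  -- The ratio is constant on each line orthogonal to the perpendicular at `e`: it is `tanh` of the
  -- displacement along it. Its minimum on `C` selects the line of this pencil that touches `C`.
  obtain ⟨p, hp, hmin⟩ := hC.exists_isMinOn ⟨z, hz⟩
    ((continuous_mink n).div (continuous_mink e.vec).neg fun x => (hg x).ne').continuousOn
  set ρ := mink n p.vec / -mink e.vec p.vec with hρ
  have hρ0 : 0 ≤ ρ := div_nonneg (h0 p hp) (hg p).le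
  have hρ1 : ρ < 1 := (div_lt_one (hg p)).2 (hlt p)
  have hD : 0 < 1 - ρ ^ 2 := by nlinarith
  set s := √(1 - ρ ^ 2) with hs
  have hs0 : 0 < s := sqrt_pos.2 hD
  have hs2 : s ^ 2 = 1 - ρ ^ 2 := sq_sqrt hD.le
  set n' : Fin 3 → ℝ := s⁻¹ • (n + ρ • e.vec) with hn'
  have hval : ∀ x, mink n' x = s⁻¹ * (mink n x - ρ * -mink e.vec x) := by
    intro x
    rw [hn', mink_smul_left, mink_add_left, mink_smul_left]; ring
  have hnn' : mink n' n' = 1 := by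
    rw [hval, mink_comm n, mink_comm e.vec, hval, hval, hn, he, hen, mink_self]
    field_simp
    rw [hs2]; ring
  have hpos : ∀ x ∈ C, 0 ≤ mink n' x.vec := by
    intro x hx
    rw [hval]
    refine mul_nonneg (inv_nonneg.2 hs0.le) (sub_nonneg.2 ?_)
    exact (le_div_iff₀ (hg x)).1 (hmin hx)
  have hle : ∀ x ∈ C, mink n' x.vec ≤ mink n x.vec := by
    intro x hx
    rw [hval, inv_mul_le_iff₀ hs0]
    -- Together with `hlt`, this gives `(1 - s) * mink n x.vec ≤ ρ * -mink e.vec x.vec`, which is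
    -- the claim.
    have h1 : 1 - ρ ≤ s := by
      apply le_sqrt_of_sq_le; nlinarith
    nlinarith [mul_le_mul_of_nonneg_right h1 (h0 x hx), mul_le_mul_of_nonneg_left (hlt x).le hρ0]
  have hsupp : Supports (lineOf n') C := by
    refine ⟨n', by rw [hnn']; norm_num, rfl, hpos, p, ?_, hp⟩
    have : mink n p.vec - ρ * -mink e.vec p.vec = 0 := by
      rw [hρ, div_mul_cancel₀ _ (hg p).ne', sub_self]
    change mink n' p.vec = 0
    rw [hval, this, mul_zero]
  obtain ⟨q, hq, hmax⟩ := hC.exists_isMaxOn ⟨z, hz⟩ (continuous_mink n').continuousOn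
  calc thickness C ≤ width (lineOf n') C := thickness_le hsupp
    _ ≤ lineDist (mink n' q.vec) := width_le_lineDist hnn' hpos fun x hx => hmax hx
    _ < lineDist w := lineDist_lt_lineDist (hpos q hq) ((hle q hq).trans_lt (hw q hq))

/-! ### Orthonormal frames and circles. -/

/-- A Lorentz orthonormal frame with time-like vector `c`. -/
structure IsFrame (c e f : Fin 3 → ℝ) : Prop where
  cc : mink c c = -1
  ee : mink e e = 1
  ff : mink f f = 1
  ce : mink c e = 0
  cf : mink c f = 0
  ef : mink e f = 0
  expand : ∀ x, x = mink e x • e + mink f x • f + (-mink c x) • c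

lemma exists_isFrame (c : Pt) : ∃ e f, IsFrame c.vec e f := by
  have hsq := c.vec_two_sq
  have hpos := c.vec_two_pos
  set p := c.vec 0 with hp
  set q := c.vec 1 with hq
  set r := c.vec 2 with hr
  have h1 : 1 + r ≠ 0 := by linarith
  have key : ∀ t : ℝ, t * (1 + r) = 1 → t * (p ^ 2 + q ^ 2) = r - 1 := by
    intro t ht
    have : p ^ 2 + q ^ 2 = (1 + r) * (r - 1) := by linarith
    rw [this, ← mul_assoc, ht, one_mul]
  obtain ⟨t, ht⟩ : ∃ t : ℝ, t * (1 + r) = 1 := ⟨(1 + r)⁻¹, inv_mul_cancel₀ h1⟩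
  have hk := key t ht
  have hc : mink c.vec c.vec = -1 := mink_self c
  -- Images of the first two basis vectors under the Lorentz boost that takes `(0, 0, 1)` to `c`.
  refine ⟨![1 + t * p ^ 2, t * p * q, p], ![t * p * q, 1 + t * q ^ 2, q], hc, ?_, ?_, ?_, ?_, ?_,
    fun x => ?_⟩
  · simp [mink]
    linear_combination t * p ^ 2 * hk + p ^ 2 * ht
  · simp [mink]
    linear_combination t * q ^ 2 * hk + q ^ 2 * ht
  · simp [mink, ← hp, ← hq, ← hr]
    linear_combination p * hk
  · simp [mink, ← hp, ← hq, ← hr]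
    linear_combination q * hk
  · simp [mink]
    linear_combination t * p * q * hk + p * q * ht
  · ext i
    fin_cases i
    · simp [mink, ← hp, ← hq, ← hr]
      linear_combination (-(t * p ^ 2 * x 0) - t * p * q * x 1 + p * x 2) * hk
        + (-(p ^ 2 * x 0) - p * q * x 1) * ht
    · simp [mink, ← hp, ← hq, ← hr]
      linear_combination (-(t * q ^ 2 * x 1) - t * p * q * x 0 + q * x 2) * hk
        + (-(q ^ 2 * x 1) - p * q * x 0) * ht
    · simp [mink, ← hp, ← hq, ← hr]
      linear_combination (-(p * x 0) - q * x 1) * hk - x 2 * hsq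

lemma IsFrame.rotate {c e f : Fin 3 → ℝ} (h : IsFrame c e f) (θ : ℝ) :
    IsFrame c (cos θ • e + sin θ • f) ((-sin θ) • e + cos θ • f) := by
  have hs := sin_sq_add_cos_sq θ
  have hfe : mink f e = 0 := by rw [mink_comm, h.ef]
  refine ⟨h.cc, ?_, ?_, ?_, ?_, ?_, fun x => ?_⟩
  · simp only [mink_add_left, mink_add_right, mink_smul_left, mink_smul_right, h.ee, h.ff, h.ef,
      hfe]
    linear_combination hs
  · simp only [mink_add_left, mink_add_right, mink_smul_left, mink_smul_right, h.ee, h.ff, h.ef,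
      hfe]
    linear_combination hs
  · simp only [mink_add_right, mink_smul_right, h.ce, h.cf]; ring
  · simp only [mink_add_right, mink_smul_right, h.ce, h.cf]; ring
  · simp only [mink_add_left, mink_add_right, mink_smul_left, mink_smul_right, h.ee, h.ff, h.ef,
      hfe]
    ring
  · have hx := h.expand x
    ext i
    have hi := congrFun hx i
    simp only [mink_add_left, mink_smul_left, Pi.add_apply, Pi.smul_apply, smul_eq_mul] at hi ⊢
    linear_combination hi - (mink e x * e i + mink f x * f i) * hs

/-- The vector at angle `θ` on the circle with centre `c` and radius `arcosh C = arsinh S`. -/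
def circ (c e f : Fin 3 → ℝ) (C S θ : ℝ) : Fin 3 → ℝ :=
  C • c + S • (cos θ • e + sin θ • f)

lemma mink_circ (n c e f : Fin 3 → ℝ) (C S θ : ℝ) :
    mink n (circ c e f C S θ) = C * mink n c + S * (cos θ * mink n e + sin θ * mink n f) := by
  simp only [circ, mink_add_right, mink_smul_right]

lemma circ_rotate (c e f : Fin 3 → ℝ) (C S θ φ : ℝ) :
    circ c (cos θ • e + sin θ • f) ((-sin θ) • e + cos θ • f) C S φ
      = circ c e f C S (θ + φ) := by
  ext i
  simp only [circ, Pi.add_apply, Pi.smul_apply, smul_eq_mul, cos_add, sin_add]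
  ring

/-! ### Regular polygons and roots of unity. -/

/-- Three consecutive vertices of an equilateral polygon inscribed in a circle. -/
lemma sq_eq_mul_of_equidistant {a b c : ℂ} (ha : a ≠ 0) (hb : b ≠ 0)
    (hab : Complex.normSq a = Complex.normSq b) (hbc : Complex.normSq b = Complex.normSq c)
    (h : (a * star b).re = (b * star c).re) (hac : a ≠ c) : b * b = a * c := by
  have hna : Complex.normSq a ≠ 0 := by simpa using ha
  have hnb : Complex.normSq b ≠ 0 := by simpa using hb
  have hu : Complex.normSq (b / a) = 1 := by rw [map_div₀, hab, div_self hnb]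
  have hw : Complex.normSq (c / b) = 1 := by rw [map_div₀, ← hbc, div_self hnb]
  have hre : (b / a).re = (c / b).re := by
    simp only [Complex.div_re, ← hab]
    simp at h
    field_simp
    linarith
  have him : (b / a).im ^ 2 = (c / b).im ^ 2 := by
    rw [Complex.normSq_apply] at hu hw
    rw [hre] at hu
    linarith
  -- The two rotations agree or are inverse; inverse ones would lead back to `a`.
  rcases sq_eq_sq_iff_eq_or_eq_neg.1 him with h1 | h1
  · have : b / a = c / b := Complex.ext hre h1
    field_simp at this
    linear_combination this
  · exfalso
    have h2 : b / a = star (c / b) := Complex.ext hre h1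
    have h3 : (c / b) * star (c / b) = 1 := by
      have := Complex.mul_conj (c / b)
      rw [hw] at this
      simpa using this
    rw [← h2] at h3
    field_simp at h3
    exact hac h3.symm

/-- The vertices of an equilateral polygon inscribed in a circle are given by the powers of a
root of unity. -/
lemma exists_isPrimitiveRoot {k : ℕ} (hk : 3 ≤ k) {z : ZMod k → ℂ}
    (hz : Function.Injective z) {ρ σ : ℝ} (hρ : ∀ i, Complex.normSq (z i) = ρ)
    (hσ : ∀ i, (z i * star (z (i + 1))).re = σ) :
    (∀ i, z i ≠ 0) ∧ ∃ ω : ℂ, IsPrimitiveRoot ω k ∧ ∀ n : ℕ, z n = z 0 * ω ^ n := by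
  have : Fact (1 < k) := ⟨by omega⟩
  have hne : ∀ i, z i ≠ 0 := by
    intro i hi
    have h0 : ∀ j, z j = 0 := fun j => by
      rw [← Complex.normSq_eq_zero, hρ j, ← hρ i, hi, map_zero]
    exact zero_ne_one (hz ((h0 0).trans (h0 1).symm))
  -- Guarantees that vertices two steps apart are distinct; this uses `3 ≤ k`.
  have h2 : (2 : ZMod k) ≠ 0 := by
    intro h
    have : ((2 : ℕ) : ZMod k) = 0 := by exact_mod_cast h
    rw [ZMod.natCast_eq_zero_iff] at this
    have := Nat.le_of_dvd (by norm_num) this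
    omega
  have hstep : ∀ i, z (i + 1) * z (i + 1) = z i * z (i + 1 + 1) := by
    intro i
    refine sq_eq_mul_of_equidistant (hne _) (hne _) (by rw [hρ, hρ]) (by rw [hρ, hρ])
      (by rw [hσ, hσ]) fun h => h2 ?_
    have := hz h
    rw [add_assoc, one_add_one_eq_two] at this
    simpa using this
  refine ⟨hne, z 1 / z 0, ?_⟩
  have hsucc : ∀ n : ℕ, z ((n : ZMod k) + 1) = z n * (z 1 / z 0) := by
    intro n
    induction n with
    | zero => simp [mul_div_cancel₀ _ (hne 0)]
    | succ n ih =>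
      have h3 := hstep n
      push_cast
      refine mul_left_cancel₀ (hne n) ?_
      rw [← h3, ← mul_assoc, mul_comm (z n), mul_assoc, ← ih]
  have hpow : ∀ n : ℕ, z n = z 0 * (z 1 / z 0) ^ n := by
    intro n
    induction n with
    | zero => simp
    | succ n ih => rw [Nat.cast_succ, hsucc, ih, pow_succ, mul_assoc]
  refine ⟨⟨?_, fun l hl => ?_⟩, hpow⟩
  · have := hpow k
    rw [ZMod.natCast_self] at this
    exact (mul_eq_left₀ (hne 0)).1 this.symm
  · have := hpow l
    rw [hl, mul_one] at this
    exact (ZMod.natCast_eq_zero_iff l k).1 (hz this)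

/-- `T` is the set of the vertices of a regular `k`-gon: seen from each of them, the polar
angles are the multiples of `2 * π / k`. -/
structure IsVertexSet (k : ℕ) (c : Fin 3 → ℝ) (C S : ℝ) (T : Set Pt) : Prop where
  finite : T.Finite
  nonempty : T.Nonempty
  S_pos : 0 < S
  C_pos : 0 < C
  C_sq : C ^ 2 = 1 + S ^ 2
  exists_frame : ∀ x ∈ T, ∃ e f, IsFrame c e f ∧ x.vec = circ c e f C S 0 ∧
    (∀ j : ℤ, ∃ y ∈ T, y.vec = circ c e f C S (2 * π * j / k)) ∧
    ∀ y ∈ T, ∃ j : ℤ, y.vec = circ c e f C S (2 * π * j / k)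

/-- In a frame at the centre the vertices have the same `c`-coordinate, and the other two form a
complex number. Equal sides become equal real parts of `z i * star (z (i + 1))`. -/
lemma IsRegularPolygon.exists_isVertexSet {k : ℕ} {V : Set Pt} (hV : IsRegularPolygon k V) :
    ∃ c C S T, IsVertexSet k c C S T ∧ V = hull T := by
  obtain ⟨hk, v, hinj, ⟨c, r, hr⟩, hside, rfl⟩ := hV
  have : NeZero k := ⟨by omega⟩
  have hk0 : (k : ℝ) ≠ 0 := by exact_mod_cast this.out
  obtain ⟨e, f, hF⟩ := exists_isFrame c
  set C := -mink c.vec (v 0).vec with hC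
  have hCi : ∀ i, -mink c.vec (v i).vec = C := fun i =>
    arcosh_injOn (one_le_neg_mink _ _) (one_le_neg_mink _ _) ((hr i).trans (hr 0).symm)
  have hC1 : 1 ≤ C := one_le_neg_mink _ _
  set z : ZMod k → ℂ := fun i => ⟨mink e (v i).vec, mink f (v i).vec⟩ with hzdef
  have hvec : ∀ i, (v i).vec = (z i).re • e + (z i).im • f + C • c.vec := fun i => by
    rw [← hCi i]; exact hF.expand _
  have hfe : mink f e = 0 := by rw [mink_comm, hF.ef]
  have hec : mink e c.vec = 0 := by rw [mink_comm, hF.ce]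
  have hfc : mink f c.vec = 0 := by rw [mink_comm, hF.cf]
  have hmink : ∀ i j, mink (v i).vec (v j).vec
      = (z i).re * (z j).re + (z i).im * (z j).im - C ^ 2 := by
    intro i j
    rw [hvec i, hvec j]
    simp only [mink_add_left, mink_add_right, mink_smul_left, mink_smul_right, hF.cc, hF.ee, hF.ff,
      hF.ce, hF.cf, hF.ef, hfe, hec, hfc]
    ring
  have hzinj : Function.Injective z := fun i j hij => hinj (Pt.vec_injective (by
    rw [hvec i, hvec j, hij]))
  have hnorm : ∀ i, Complex.normSq (z i) = C ^ 2 - 1 := by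
    intro i
    have := hmink i i
    rw [mink_self] at this
    rw [Complex.normSq_apply]; linarith
  have hre : ∀ i, (z i * star (z (i + 1))).re = mink (v 0).vec (v (0 + 1)).vec + C ^ 2 := by
    intro i
    have h1 := arcosh_injOn (one_le_neg_mink _ _) (one_le_neg_mink _ _) (hside i 0)
    have h2 := hmink i (i + 1)
    have h3 : (z i * star (z (i + 1))).re
        = (z i).re * (z (i + 1)).re + (z i).im * (z (i + 1)).im := by simp
    rw [h3]
    linarith
  obtain ⟨hne, ω, hω, hpow⟩ := exists_isPrimitiveRoot hk hzinj hnorm hre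
  have hval : ∀ i : ZMod k, z i = z 0 * ω ^ i.val := fun i => by
    rw [← hpow, ZMod.natCast_zmod_val]
  have hS : 0 < C ^ 2 - 1 := by
    rw [← hnorm 0]; exact Complex.normSq_pos.2 (hne 0)
  have hnz : ∀ i, ‖z i‖ = √(C ^ 2 - 1) := fun i => by
    rw [← hnorm i]; rfl
  have hcirc : ∀ i i₀ : ZMod k, ∀ φ : ℝ, z i = z i₀ * Complex.exp (φ * Complex.I) →
      (v i).vec = circ c.vec e f C √(C ^ 2 - 1) ((z i₀).arg + φ) := by
    intro i i₀ φ h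
    have h1 : z i = (√(C ^ 2 - 1) : ℝ) * Complex.exp (((z i₀).arg + φ : ℝ) * Complex.I) := by
      rw [h, ← hnz i₀]
      conv_lhs => rw [← Complex.norm_mul_exp_arg_mul_I (z i₀)]
      rw [mul_assoc, ← Complex.exp_add]
      push_cast
      ring_nf
    rw [hvec i, h1, Complex.re_ofReal_mul, Complex.im_ofReal_mul, Complex.exp_ofReal_mul_I_re,
      Complex.exp_ofReal_mul_I_im, circ]
    simp only [smul_add, smul_smul]
    abel
  refine ⟨c.vec, C, √(C ^ 2 - 1), Set.range v, ⟨Set.finite_range v, ⟨_, 0, rfl⟩, sqrt_pos.2 hS,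
    by linarith, by rw [sq_sqrt hS.le]; ring, ?_⟩, rfl⟩
  rintro _ ⟨i₀, rfl⟩
  refine ⟨_, _, hF.rotate (z i₀).arg, ?_, ?_, ?_⟩
  · rw [circ_rotate]
    exact hcirc i₀ i₀ 0 (by simp)
  · intro j
    set ζ := Complex.exp ((2 * π * j / k : ℝ) * Complex.I) with hζ
    have h1 : ζ ^ k = 1 := by
      rw [hζ, ← Complex.exp_nat_mul]
      rw [Complex.exp_eq_one_iff]
      refine ⟨j, ?_⟩
      have : (k : ℂ) ≠ 0 := by exact_mod_cast hk0
      push_cast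
      field_simp
    -- `ω` may be any primitive root, so the given order may trace a star; its powers still exhaust
    -- the `k`-th roots of unity.
    obtain ⟨n, -, hn⟩ := hω.eq_pow_of_pow_eq_one h1
    refine ⟨v (i₀ + n), ⟨_, rfl⟩, ?_⟩
    rw [circ_rotate]
    refine hcirc _ _ _ ?_
    rw [← hζ, ← hn, hval i₀, mul_assoc, ← pow_add, ← hpow]
    simp
  · rintro _ ⟨i, rfl⟩
    have h1 : (z i / z i₀) ^ k = 1 := by
      rw [hval i, hval i₀, mul_div_mul_left _ _ (hne 0), div_pow, ← pow_mul, ← pow_mul,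
        mul_comm, pow_mul, mul_comm, pow_mul, hω.pow_eq_one]
      simp
    obtain ⟨n, -, hn⟩ := (Complex.isPrimitiveRoot_exp k this.out).eq_pow_of_pow_eq_one h1
    refine ⟨n, ?_⟩
    rw [circ_rotate]
    refine hcirc _ _ _ ?_
    have h2 : Complex.exp ((2 * π * (n : ℤ) / k : ℝ) * Complex.I) = z i / z i₀ := by
      rw [← hn, ← Complex.exp_nat_mul]
      congr 1
      push_cast
      ring
    rw [h2, mul_div_cancel₀ _ (hne i₀)]

/-! ### Trigonometric estimates. -/

/-- No vertex lies beyond the side opposite to a given vertex. Oddness is essential: for even `k`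
the angle `π` occurs. -/
lemma neg_cos_le_cos_of_odd {k : ℕ} (hk : Odd k) (j : ℤ) :
    -cos (π / k) ≤ cos (2 * π * j / k) := by
  obtain ⟨m, rfl⟩ := hk
  set k := 2 * m + 1 with hkdef
  have hk0 : (0 : ℝ) < k := by positivity
  -- The integer nearest to `j / k`, so the reduced angle is at most `2 * π * m / k = π - π / k`.
  set q := (j + m) / (k : ℤ) with hq
  have h1 : (k : ℤ) * q ≤ j + m := Int.mul_ediv_self_le (by omega)
  have h2 : j + m < k * q + k := Int.lt_mul_ediv_self_add (by omega)
  have habs : |j - k * q| ≤ m := by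
    rw [abs_le]; constructor <;> omega
  have habs' : |(j : ℝ) - k * q| ≤ m := by exact_mod_cast habs
  have hkm : (k : ℝ) = 2 * m + 1 := by rw [hkdef]; push_cast; ring
  have h3 : cos (2 * π * j / k) = cos |2 * π * (j - k * q) / k| := by
    rw [cos_abs, ← cos_sub_int_mul_two_pi (2 * π * j / k) q]
    congr 1
    field_simp
  rw [h3, ← cos_pi_sub]
  refine cos_le_cos_of_nonneg_of_le_pi (abs_nonneg _) ?_ ?_
  · have : 0 < π / k := by positivity
    linarith
  · rw [abs_div, abs_mul, abs_of_pos (by positivity : 0 < 2 * π), abs_of_pos hk0,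
      div_le_iff₀ hk0, sub_mul, div_mul_cancel₀ _ hk0.ne']
    nlinarith [pi_pos]

/-- The unit vector `(a, b)` describes a line through a vertex, and `h` keeps both neighbouring
vertices on one side. The right-hand side is concave in the angle of `(a, b)`. Equality holds at `a
= c / D`, where the line contains a side; at `a = 1` the claim reduces to `1 ≤ D`. -/
lemma width_bound {a b C c s D : ℝ} (ha : 0 ≤ a) (hb : 0 ≤ b) (hab : a ^ 2 + b ^ 2 = 1)
    (hC : 1 ≤ C) (hc0 : 0 < c) (hc1 : c < 1) (hs : 0 < s) (hcs : s ^ 2 + c ^ 2 = 1)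
    (hD : 0 < D) (hD2 : D ^ 2 = c ^ 2 + C ^ 2 * s ^ 2) (h : b * c ≤ C * a * s) :
    C * (1 + c) / D ≤ C * a * (1 + c) + b * s := by
  rw [div_le_iff₀ hD]
  have hy : c ≤ a * D := by
    refine le_of_sq_le_sq ?_ (by positivity)
    have : (b * c) ^ 2 ≤ (C * a * s) ^ 2 := by gcongr
    rw [mul_pow, hD2]
    nlinarith
  rcases le_or_gt 1 (a * D) with h1 | h1
  · have h2 : C * (1 + c) * 1 ≤ C * (1 + c) * (a * D) := by gcongr
    have h3 : 0 ≤ b * s * D := by positivity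
    linarith
  · suffices hsuff : C * (1 + c) * (1 - a * D) ≤ b * s * D by linarith
    refine le_of_sq_le_sq ?_ (by positivity)
    set y := a * D with hydef
    have e1 : (b * s * D) ^ 2 = (1 - c) * (1 + c) * (D ^ 2 - y ^ 2) := by
      have hb2 : b ^ 2 = 1 - a ^ 2 := by linarith
      have hs2 : s ^ 2 = (1 - c) * (1 + c) := by linarith
      rw [hydef, mul_pow, mul_pow, hb2, hs2]; ring
    have hs2 : s ^ 2 = (1 - c) * (1 + c) := by linarith
    -- The factor `y - c` reflects the equality case.
    have e2 : (b * s * D) ^ 2 - (C * (1 + c) * (1 - y)) ^ 2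
        = (1 + c) * ((y - c) * (C ^ 2 * ((1 + c) * (2 - c - y)) - (1 - c) * (y + c))) := by
      rw [e1, hD2, hs2]; ring
    have h4 : (1 + c) * (2 - c - y) ≤ C ^ 2 * ((1 + c) * (2 - c - y)) := by
      refine le_mul_of_one_le_left ?_ (by nlinarith)
      exact mul_nonneg (by linarith) (by linarith)
    have h5 : (1 - c) * (y + c) ≤ (1 + c) * (2 - c - y) := by nlinarith
    have h6 : 0 ≤ (1 + c) * ((y - c) * (C ^ 2 * ((1 + c) * (2 - c - y)) - (1 - c) * (y + c))) :=
      mul_nonneg (by linarith) (mul_nonneg (by linarith) (by linarith))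
    linarith

/-- The angles at a vertex: half of the central angle of a side. -/
lemma central_angle {k : ℕ} (hk : 3 ≤ k) :
    0 < cos (π / k) ∧ cos (π / k) < 1 ∧ 0 < sin (π / k) := by
  have hk3 : (3 : ℝ) ≤ k := by exact_mod_cast hk
  have h0 : 0 < π / k := by positivity
  have h1 : π / k ≤ π / 3 := by gcongr
  have hs : 0 < sin (π / k) := sin_pos_of_pos_of_lt_pi h0 (by linarith [pi_pos])
  refine ⟨cos_pos_of_mem_Ioo ⟨by linarith [pi_pos], by linarith [pi_pos]⟩, ?_, hs⟩
  nlinarith [sin_sq_add_cos_sq (π / k)]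

/-! ### Thickness and reducedness of odd regular polygons. -/

/-- `sinh` of the thickness of a regular polygon with an odd number `k` of vertices. -/
def sideWidth (k : ℕ) (C S : ℝ) : ℝ :=
  S * C * (1 + cos (π / k)) / √(cos (π / k) ^ 2 + C ^ 2 * sin (π / k) ^ 2)

section

variable {k : ℕ} {c : Fin 3 → ℝ} {C S : ℝ} {T : Set Pt}

lemma sideWidth_pos (hk : 3 ≤ k) (hT : IsVertexSet k c C S T) : 0 < sideWidth k C S := by
  obtain ⟨hc0, -, hs⟩ := central_angle hk
  have := hT.S_pos
  have := hT.C_pos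
  unfold sideWidth
  positivity

lemma IsVertexSet.isConvexBody_hull (hk : 3 ≤ k) (hT : IsVertexSet k c C S T) :
    IsConvexBody (hull T) := by
  obtain ⟨x, hx⟩ := hT.nonempty
  obtain ⟨e, f, hF, -, h, -⟩ := hT.exists_frame x hx
  choose y hyT hy using h
  obtain ⟨hc0, -, hs⟩ := central_angle hk
  -- A vertex and its two neighbours are independent because `sin (2 * π / k)` is positive.
  refine HypPlane.isConvexBody_hull hT.finite (v := ![y 0, y 1, y (-1)])
    (by intro i; fin_cases i <;> simp [hyT]) ?_
  rw [Fintype.linearIndependent_iff]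
  intro g hg
  have hfe : mink f e = 0 := by rw [mink_comm, hF.ef]
  have hec : mink e c = 0 := by rw [mink_comm, hF.ce]
  have hfc : mink f c = 0 := by rw [mink_comm, hF.cf]
  have hsum : ∀ n, g 0 * mink n (y 0).vec + g 1 * mink n (y 1).vec
      + g 2 * mink n (y (-1)).vec = 0 := by
    intro n
    have h0 : mink n (0 : Fin 3 → ℝ) = 0 := by simp [mink]
    rw [← mink_smul_right, ← mink_smul_right, ← mink_smul_right, ← mink_add_right,
      ← mink_add_right, ← h0, ← hg, Fin.sum_univ_three]
    simp
  have a0 : 2 * π * ((0 : ℤ) : ℝ) / k = 0 := by simp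
  have a1 : 2 * π * ((1 : ℤ) : ℝ) / k = 2 * (π / k) := by push_cast; ring
  have a2 : 2 * π * ((-1 : ℤ) : ℝ) / k = -(2 * (π / k)) := by push_cast; ring
  have ec := hsum c
  have ee := hsum e
  have ef := hsum f
  simp only [hy, a0, a1, a2, mink_circ, hF.cc, hF.ee, hF.ff, hF.ce, hF.cf, hF.ef, hfe, hec, hfc,
    cos_zero, sin_zero, cos_neg, sin_neg] at ec ee ef
  have hsin2 : 0 < sin (2 * (π / k)) := by rw [sin_two_mul]; positivity
  have hcos2 : cos (2 * (π / k)) = 1 - 2 * sin (π / k) ^ 2 := by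
    rw [cos_two_mul]; linarith [sin_sq_add_cos_sq (π / k)]
  rw [hcos2] at ee
  have f1 : C * (g 0 + g 1 + g 2) = 0 := by linear_combination -ec
  have f2 : S * sin (2 * (π / k)) * (g 1 - g 2) = 0 := by linear_combination ef
  have f1' := (mul_eq_zero.1 f1).resolve_left hT.C_pos.ne'
  have f2' := (mul_eq_zero.1 f2).resolve_left (mul_pos hT.S_pos hsin2).ne'
  have f3 : S * sin (π / k) ^ 2 * (g 1 + g 2) = 0 := by
    linear_combination (S / 2) * f1' - ee / 2
  have f3' := (mul_eq_zero.1 f3).resolve_left (mul_pos hT.S_pos (pow_pos hs 2)).ne'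
  intro i
  fin_cases i
  · change g 0 = 0
    linarith
  · change g 1 = 0
    linarith
  · change g 2 = 0
    linarith

/-- The normal of the side opposite to a vertex `x`. -/
lemma IsVertexSet.exists_side_normal (hk : Odd k) (hk3 : 3 ≤ k) (hT : IsVertexSet k c C S T)
    {x : Pt} (hx : x ∈ T) : ∃ n : Fin 3 → ℝ, mink n n = 1 ∧ (∀ y ∈ T, 0 ≤ mink n y.vec) ∧
      (∃ y ∈ T, mink n y.vec = 0) ∧ mink n x.vec = sideWidth k C S ∧
      ∀ y ∈ T, y = x ∨ mink n y.vec < mink n x.vec := by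
  obtain ⟨e, f, hF, hx0, hex, hall⟩ := hT.exists_frame x hx
  obtain ⟨hc0, hc1, hs⟩ := central_angle hk3
  have hS := hT.S_pos
  have hC := hT.C_pos
  have hec : mink e c = 0 := by rw [mink_comm, hF.ce]
  set δ := π / k with hδ
  set D := √(cos δ ^ 2 + C ^ 2 * sin δ ^ 2) with hD
  have hD0 : 0 < D := by positivity
  have hD2 : D ^ 2 = cos δ ^ 2 + C ^ 2 * sin δ ^ 2 := sq_sqrt (by positivity)
  -- The height at angle `θ` is proportional to `cos θ + cos δ`, so it vanishes at `π ± δ`, the ends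
  -- of the opposite side.
  set n : Fin 3 → ℝ := D⁻¹ • (C • e + (-(S * cos δ)) • c) with hn
  have hval : ∀ p, mink n p = D⁻¹ * (C * mink e p - S * cos δ * mink c p) := by
    intro p
    rw [hn, mink_smul_left, mink_add_left, mink_smul_left, mink_smul_left]; ring
  have hcirc : ∀ θ, mink n (circ c e f C S θ) = S * C * (cos θ + cos δ) / D := by
    intro θ
    rw [hval, mink_circ, mink_circ, hF.cc, hF.ee, hF.ce, hF.cf, hF.ef, hec]
    field_simp
    ring
  have hnx : mink n x.vec = sideWidth k C S := by
    rw [hx0, hcirc, cos_zero, sideWidth]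
  refine ⟨n, ?_, ?_, ?_, hnx, ?_⟩
  · rw [hval, mink_comm e, mink_comm c, hval, hval, hF.ee, hF.cc, hF.ce, hec]
    have h1 : C ^ 2 - S ^ 2 * cos δ ^ 2 = D ^ 2 := by
      rw [hD2]
      linear_combination (C ^ 2) * (-(sin_sq_add_cos_sq δ)) + cos δ ^ 2 * hT.C_sq
    field_simp
    linear_combination h1
  · intro y hy
    obtain ⟨j, hj⟩ := hall y hy
    rw [hj, hcirc]
    have := neg_cos_le_cos_of_odd hk j
    exact div_nonneg (mul_nonneg (by positivity) (by linarith)) hD0.le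
  · obtain ⟨m, hm⟩ := hk
    obtain ⟨y, hy, hyv⟩ := hex m
    refine ⟨y, hy, ?_⟩
    have hk0 : (k : ℝ) ≠ 0 := by
      have : k ≠ 0 := by omega
      exact_mod_cast this
    have : 2 * π * ((m : ℤ) : ℝ) / k = π - δ := by
      have hkm : (k : ℝ) = 2 * m + 1 := by rw [hm]; push_cast; ring
      rw [hδ]
      field_simp
      rw [hkm]; push_cast; ring
    rw [hyv, hcirc, this, cos_pi_sub]
    simp
  · intro y hy
    obtain ⟨j, hj⟩ := hall y hy
    rcases (cos_le_one (2 * π * j / k)).eq_or_lt with h1 | h1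
    · left
      have h2 : sin (2 * π * j / k) = 0 := by
        nlinarith [sin_sq_add_cos_sq (2 * π * j / k)]
      apply Pt.vec_injective
      rw [hj, hx0, circ, circ, h1, h2, cos_zero, sin_zero]
    · right
      rw [hj, hx0, hcirc, hcirc, cos_zero]
      gcongr

/-- A supporting line through a vertex is far from one of the two opposite vertices. -/
lemma IsVertexSet.sideWidth_le (hk : Odd k) (hk3 : 3 ≤ k) (hT : IsVertexSet k c C S T)
    {n : Fin 3 → ℝ} (hn : mink n n = 1) (h0 : ∀ y ∈ T, 0 ≤ mink n y.vec) {x : Pt} (hx : x ∈ T)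
    (hx0 : mink n x.vec = 0) : ∃ q ∈ T, sideWidth k C S ≤ mink n q.vec := by
  obtain ⟨e, f, hF, hxv, hex, -⟩ := hT.exists_frame x hx
  obtain ⟨hc0, hc1, hs⟩ := central_angle hk3
  have hS := hT.S_pos
  have hC := hT.C_pos
  have hC1 : 1 ≤ C := by nlinarith [hT.C_sq]
  set δ := π / k with hδ
  set A := mink n e with hA
  set B := mink n f with hB
  set G := mink n c with hG
  have hcirc : ∀ θ, mink n (circ c e f C S θ) = S * (A * (cos θ - 1) + B * sin θ) := by
    intro θ
    rw [hxv, mink_circ, cos_zero, sin_zero] at hx0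
    rw [mink_circ]
    linear_combination hx0
  have hCG : C * G = -(S * A) := by
    rw [hxv, mink_circ, cos_zero, sin_zero] at hx0
    linear_combination hx0
  have hABG : A ^ 2 + B ^ 2 - G ^ 2 = 1 := by
    have h := congrArg (mink n) (hF.expand n)
    simp only [mink_add_right, mink_smul_right, mink_comm e n, mink_comm f n, mink_comm c n] at h
    rw [← hn, h]; ring
  -- Incidence with `x` eliminates `G` from the unit length of `n`.
  have hAC : (-A / C) ^ 2 + |B| ^ 2 = 1 := by
    have h1 : C ^ 2 * G ^ 2 = S ^ 2 * A ^ 2 := by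
      rw [← mul_pow, hCG]; ring
    rw [sq_abs]
    field_simp
    linear_combination C ^ 2 * hABG + h1 - A ^ 2 * hT.C_sq
  have hsq := sin_sq_add_cos_sq δ
  have hangle : ∀ j : ℤ, 0 ≤ A * (cos (2 * π * j / k) - 1) + B * sin (2 * π * j / k) := by
    intro j
    obtain ⟨y, hy, hyv⟩ := hex j
    have := h0 y hy
    rw [hyv, hcirc] at this
    exact (mul_nonneg_iff_of_pos_left hS).1 this
  -- Only the two neighbours of `x` (`j = 1` and `j = -1`) restrict the slope here.
  have hside : |B| * cos δ ≤ -A * sin δ := by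
    have a1 : 2 * π * ((1 : ℤ) : ℝ) / k = 2 * δ := by rw [hδ]; push_cast; ring
    have a2 : 2 * π * ((-1 : ℤ) : ℝ) / k = -(2 * δ) := by rw [hδ]; push_cast; ring
    have h1 := hangle 1
    have h2 := hangle (-1)
    rw [a1, cos_two_mul, sin_two_mul] at h1
    rw [a2, cos_neg, sin_neg, cos_two_mul, sin_two_mul] at h2
    have h1' : 0 ≤ 2 * sin δ * (-A * sin δ + B * cos δ) := by
      linear_combination h1 + 2 * A * hsq
    have h2' : 0 ≤ 2 * sin δ * (-A * sin δ - B * cos δ) := by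
      linear_combination h2 + 2 * A * hsq
    have h1'' := (mul_nonneg_iff_of_pos_left (by positivity)).1 h1'
    have h2'' := (mul_nonneg_iff_of_pos_left (by positivity)).1 h2'
    rw [show |B| * cos δ = |B * cos δ| by rw [abs_mul, abs_of_pos hc0], abs_le]
    constructor <;> linarith
  have hA0 : 0 ≤ -A := by
    have : 0 ≤ -A * sin δ := le_trans (by positivity) hside
    exact (mul_nonneg_iff_of_pos_right hs).1 this
  have hbound := width_bound (a := -A / C) (b := |B|) (C := C) (c := cos δ) (s := sin δ)
    (D := √(cos δ ^ 2 + C ^ 2 * sin δ ^ 2)) (by positivity) (abs_nonneg B) hAC hC1 hc0 hc1 hs hsq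
    (by positivity) (sq_sqrt (by positivity)) (by rwa [mul_div_cancel₀ _ hC.ne'])
  rw [mul_div_cancel₀ _ hC.ne'] at hbound
  have hw : sideWidth k C S ≤ S * (-A * (1 + cos δ) + |B| * sin δ) := by
    rw [sideWidth, mul_assoc, mul_div_assoc]
    exact mul_le_mul_of_nonneg_left hbound hS.le
  obtain ⟨m, hm⟩ := hk
  have hkm : (k : ℝ) = 2 * m + 1 := by rw [hm]; push_cast; ring
  have hk0 : (k : ℝ) ≠ 0 := by rw [hkm]; positivity
  -- The sign of `B` tells which of the vertices at `π - δ` and `π + δ` is farther.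
  rcases le_total 0 B with hB0 | hB0
  · obtain ⟨q, hq, hqv⟩ := hex m
    have : 2 * π * ((m : ℤ) : ℝ) / k = π - δ := by
      rw [hδ]
      field_simp
      rw [hkm]; push_cast; ring
    refine ⟨q, hq, hw.trans_eq ?_⟩
    rw [hqv, hcirc, this, cos_pi_sub, sin_pi_sub, abs_of_nonneg hB0]
    ring
  · obtain ⟨q, hq, hqv⟩ := hex (m + 1)
    have : 2 * π * ((m + 1 : ℤ) : ℝ) / k = δ + π := by
      rw [hδ]
      field_simp
      rw [hkm]; push_cast; ring
    refine ⟨q, hq, hw.trans_eq ?_⟩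
    rw [hqv, hcirc, this, cos_add_pi, sin_add_pi, abs_of_nonpos hB0]
    ring

lemma IsVertexSet.isReduced_hull (hk : Odd k) (hk3 : 3 ≤ k) (hT : IsVertexSet k c C S T) :
    IsReduced (hull T) := by
  have hbody := hT.isConvexBody_hull hk3
  have hw := sideWidth_pos hk3 hT
  refine ⟨hbody, fun Z hZ hZT => ?_⟩
  have hlow : lineDist (sideWidth k C S) ≤ thickness (hull T) := by
    refine lineDist_le_thickness hbody.isCompact hw ?_ ?_
    · obtain ⟨x, hx⟩ := hT.nonempty
      obtain ⟨n, hn, h0, ⟨y, hy, hy0⟩, -⟩ := hT.exists_side_normal hk hk3 hx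
      exact ⟨lineOf n, n, by rw [hn]; norm_num, rfl, hull_subset (isConvex_nonneg n) h0, y, hy0,
        subset_hull T hy⟩
    · rintro n hn h0 ⟨x, hx, hx0⟩
      -- If all vertices had positive height, so would the whole hull.
      obtain ⟨y, hy, hy0⟩ : ∃ y ∈ T, mink n y.vec = 0 := by
        by_contra! hne
        have := hull_subset (isConvex_pos n)
          (fun y hy => lt_of_le_of_ne (h0 y (subset_hull T hy)) (hne y hy).symm) hx
        exact this.ne' hx0
      obtain ⟨q, hq, hwq⟩ := hT.sideWidth_le hk hk3 hn (fun y hy => h0 y (subset_hull T hy)) hy hy0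
      exact ⟨q, subset_hull T hq, hwq⟩
  -- A convex `Z` containing all vertices would contain their hull.
  obtain ⟨x, hx, hxZ⟩ : ∃ x ∈ T, x ∉ Z := by
    by_contra! h
    exact hZT.2 (hull_subset hZ.isConvex h)
  obtain ⟨n, hn, h0, -, hnx, hpeak⟩ := hT.exists_side_normal hk hk3 hx
  refine lt_of_lt_of_le ?_ hlow
  refine thickness_lt_lineDist hZ.isCompact (hZ.nonempty_interior.mono interior_subset) hn
    (fun z hz => hull_subset (isConvex_nonneg n) h0 (hZT.1 hz)) fun z hz => ?_
  rcases hull_subset (isConvex_peak n x (by rwa [hnx])) hpeak (hZT.1 hz) with rfl | h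
  · exact absurd hz hxZ
  · rwa [hnx] at h

end

end HypPlane

end

theorem corollary1 (k : ℕ) (hk : Odd k) (V : Set HypPlane.Pt)
    (hV : HypPlane.IsRegularPolygon k V) : HypPlane.IsReduced V := by
  obtain ⟨c, C, S, T, hT, rfl⟩ := hV.exists_isVertexSet
  exact hT.isReduced_hull hk hV.1
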